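/- Let $n>1$ be an integer and let $$D^{n,1}=\{(z_0,\dots,z_n)\in\mathbb{C}^{n+1} : -|z_0|^2+|z_1|^2+\cdots+|z_n|^2>0\}.$$ Let $\mathrm{Aut}(D^{n,1})$ be the group of all biholomorphic maps of $D^{n,1}$ onto itself, equipped with the compact-open topology. If $\Gamma$ is a discrete subgroup of $\mathrm{Aut}(D^{n,1})$ that acts properly discontinuously on $D^{n,1}$ (that is, for all compact sets $K,L\subset D^{n,1}$ only finitely many $\gamma\in\Gamma$ satisfy $\gamma(K)\cap L\neq\emptyset$), then the quotient space $D^{n,1}/\Gamma$ is not compact. -/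

import Mathlib

open TopologicalSpace

/-- A self-map `f` of an open subset `Ω` of a complex normed space is holomorphic: it is complex
differentiable at every point of `Ω` (as the restriction to `Ω` of a map of the whole space). -/
def IsHolomorphicSelfMap {E : Type*} [NormedAddCommGroup E] [NormedSpace ℂ E]
    (Ω : Opens E) (f : Ω → Ω) : Prop :=
  ∃ F : E → E, DifferentiableOn ℂ F (Ω : Set E) ∧ ∀ z : Ω, F (z : E) = (f z : E)

/-- `Aut(Ω)`: the group, under composition, of all biholomorphic maps of the open set `Ω` onto
itself. -/
def HolAut {E : Type*} [NormedAddCommGroup E] [NormedSpace ℂ E] (Ω : Opens E) :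
    Subgroup (Ω ≃ₜ Ω) where
  carrier := {f | IsHolomorphicSelfMap Ω f ∧ IsHolomorphicSelfMap Ω f.symm}
  one_mem' := ⟨⟨id, differentiableOn_id, fun _ => rfl⟩, ⟨id, differentiableOn_id, fun _ => rfl⟩⟩
  mul_mem' := by
    rintro f g ⟨⟨F, hF, hFf⟩, ⟨F', hF', hFf'⟩⟩ ⟨⟨G, hG, hGg⟩, ⟨G', hG', hGg'⟩⟩
    refine ⟨⟨F ∘ G, hF.comp hG fun z hz => ?_, fun z => ?_⟩,
      ⟨G' ∘ F', hG'.comp hF' fun z hz => ?_, fun z => ?_⟩⟩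
    · rw [hGg ⟨z, hz⟩]
      exact (g ⟨z, hz⟩).2
    · rw [Function.comp_apply, hGg, hFf]
      rfl
    · rw [hFf' ⟨z, hz⟩]
      exact (f.symm ⟨z, hz⟩).2
    · rw [Function.comp_apply, hFf', hGg']
      rfl
  inv_mem' := fun h => ⟨h.2, h.1⟩

/-- `Aut(Ω)` carries the compact-open topology. -/
instance HolAut.instTopologicalSpace {E : Type*} [NormedAddCommGroup E] [NormedSpace ℂ E]
    (Ω : Opens E) : TopologicalSpace (HolAut Ω) :=
  TopologicalSpace.induced (fun f => ((f : Ω ≃ₜ Ω) : C(Ω, Ω))) ContinuousMap.compactOpen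

/-- `Aut(Ω)` acts on `Ω` by evaluation. -/
instance HolAut.instMulAction {E : Type*} [NormedAddCommGroup E] [NormedSpace ℂ E]
    (Ω : Opens E) : MulAction (HolAut Ω) Ω where
  smul f z := (f : Ω ≃ₜ Ω) z
  one_smul _ := rfl
  mul_smul _ _ _ := rfl

/-- The domain `D^{n,1} = {z ∈ ℂ^{n+1} : -|z₀|² + |z₁|² + ⋯ + |zₙ|² > 0}`. -/
def domainD (n : ℕ) : Opens (Fin (n + 1) → ℂ) where
  carrier := {z | 0 < -‖z 0‖ ^ 2 + ∑ i : Fin n, ‖z i.succ‖ ^ 2}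
  is_open' := isOpen_lt continuous_const (by fun_prop)

/-! Write Q for `lorentzForm`. For n > 1 a Hartogs argument extends an automorphism and its inverse
to mutually inverse maps Φ, Ψ of ℂ^{n+1}, which preserve {Q ≤ 0} (`hartogsExtension_leftInverse`).
Holomorphy is tracked only along entire curves, so one-variable theorems suffice.

On {Q ≤ 0} the zeroth coordinate dominates, so Liouville's theorem makes Φ carry complex lines of
this cone to complex lines. The restrictions are automorphisms of ℂ fixing 0, hence linear. The
identity theorem spreads homogeneity to ℂ^{n+1}, and a homogeneous holomorphic map is linear
(`exists_linearMap_of_holAut`). Preserving the sign of Q then forces Q ∘ A = r Q with r > 0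
(`exists_lorentzForm_map_eq_mul`).

If the quotient were compact, translates of a compact K would cover the domain. Any γ carrying a
point of K into {Q = 1} has r in a fixed interval [c⁻¹, c]. As n + 1 > 2, some h with Q h = 1 has
zeroth coordinate 0 both before and after γ, so γ L meets L for one compact L independent of γ. Only
finitely many γ do this, so finitely many translates of K cover {Q = 1}, which is unbounded. -/

open Filter Topology Metric MeasureTheory

/-! ### Entire functions of one variable -/

section OneVariable

variable {E : Type*} [NormedAddCommGroup E] [NormedSpace ℂ E]

/-- A circle integral depending holomorphically on a parameter is holomorphic in the parameter. -/
theorem differentiableAt_circleIntegral_of_continuousOn {g : ℂ → ℂ → E} {t₀ c : ℂ} {ε R : ℝ}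
    (hε : 0 < ε) (hR : 0 ≤ R)
    (hcont : ContinuousOn (Function.uncurry g) (closedBall t₀ ε ×ˢ sphere c R))
    (hdiff : ∀ w ∈ sphere c R, DifferentiableOn ℂ (fun t => g t w) (ball t₀ ε)) :
    DifferentiableAt ℂ (fun t => ∮ w in C(c, R), g t w) t₀ := by
  obtain ⟨M, hM⟩ := ((isCompact_closedBall t₀ ε).prod (isCompact_sphere c R)).exists_bound_of_continuousOn
    hcont
  have hc : ∀ t ∈ closedBall t₀ ε, Continuous fun θ : ℝ => g t (circleMap c R θ) := by
    intro t ht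
    exact hcont.comp_continuous (f := fun θ : ℝ => (t, circleMap c R θ)) (by fun_prop)
      fun θ => ⟨ht, circleMap_mem_sphere c hR θ⟩
  have hc' : Continuous fun θ : ℝ => deriv (circleMap c R) θ := by
    simp only [deriv_circleMap]; fun_prop
  have hbc : ball t₀ ε ⊆ closedBall t₀ ε := ball_subset_closedBall
  have hda : ∀ θ : ℝ, ∀ t ∈ ball t₀ ε,
      HasDerivAt (fun t => g t (circleMap c R θ)) (deriv (fun t => g t (circleMap c R θ)) t) t := by
    intro θ t ht
    exact ((hdiff _ (circleMap_mem_sphere c hR θ)).differentiableAt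
      (isOpen_ball.mem_nhds ht)).hasDerivAt
  have key := intervalIntegral.hasDerivAt_integral_of_dominated_loc_of_deriv_le (μ := volume)
    (a := 0) (b := 2 * Real.pi)
    (F := fun t θ => deriv (circleMap c R) θ • g t (circleMap c R θ))
    (F' := fun t θ => deriv (circleMap c R) θ • deriv (fun t => g t (circleMap c R θ)) t)
    (x₀ := t₀) (s := ball t₀ (ε / 2)) (bound := fun _ => R * (M / (ε / 2)))
    (ball_mem_nhds _ (by positivity)) ?_ ?_ ?_ ?_ ?_ ?_
  · exact key.2.differentiableAt
  · filter_upwards [ball_mem_nhds t₀ hε] with t ht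
    exact (hc'.smul (hc t (hbc ht))).aestronglyMeasurable
  · exact (hc'.smul (hc t₀ (mem_closedBall_self hε.le))).intervalIntegrable _ _
  · refine (hc'.aestronglyMeasurable).smul ?_
    -- The derivative is measurable in θ as a limit of difference quotients, each continuous in θ.
    have hs : ∀ k : ℕ, (t₀ + ((ε / (k + 1) : ℝ) : ℂ)) ∈ closedBall t₀ ε := by
      intro k
      rw [mem_closedBall, dist_eq_norm, add_sub_cancel_left, Complex.norm_real, Real.norm_eq_abs,
        abs_of_pos (by positivity)]
      exact div_le_self hε.le (by simp)
    have hlim : Tendsto (fun k : ℕ => t₀ + ((ε / (k + 1) : ℝ) : ℂ)) atTop (𝓝[≠] t₀) := by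
      refine tendsto_nhdsWithin_iff.2 ⟨?_, Eventually.of_forall fun k => ?_⟩
      · have h1 : Tendsto (fun k : ℕ => ε / ((k : ℝ) + 1)) atTop (𝓝 0) :=
          tendsto_const_nhds.div_atTop (tendsto_atTop_add_const_right _ _ tendsto_natCast_atTop_atTop)
        have h2 := (Complex.continuous_ofReal.tendsto 0).comp h1
        simpa using tendsto_const_nhds (x := t₀) |>.add h2
      · have : ((ε / ((k : ℝ) + 1) : ℝ) : ℂ) ≠ 0 := Complex.ofReal_ne_zero.2 (by positivity)
        rw [Set.mem_compl_singleton_iff]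
        exact fun e => this (by simpa using e)
    refine aestronglyMeasurable_of_tendsto_ae atTop
      (f := fun (k : ℕ) θ => slope (fun t => g t (circleMap c R θ)) t₀
        (t₀ + ((ε / (k + 1) : ℝ) : ℂ))) (fun k => ?_) (Eventually.of_forall fun θ => ?_)
    · simp only [slope_def_module]
      exact (((hc _ (hs k)).sub (hc _ (mem_closedBall_self hε.le))).const_smul _).aestronglyMeasurable
    · exact (hasDerivAt_iff_tendsto_slope.1 (hda θ t₀ (mem_ball_self hε))).comp hlim
  -- Cauchy's estimate on the disc of radius ε / 2 about t, which stays in the ε-ball.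
  · refine Eventually.of_forall fun θ _ t ht => ?_
    rw [norm_smul, deriv_circleMap, norm_mul, Complex.norm_I, mul_one, norm_circleMap_zero,
      abs_of_nonneg hR]
    refine mul_le_mul_of_nonneg_left ?_ hR
    have hsub : closedBall t (ε / 2) ⊆ ball t₀ ε := by
      intro x hx
      rw [mem_ball] at ht ⊢
      rw [mem_closedBall] at hx
      linarith [dist_triangle x t t₀]
    refine Complex.norm_deriv_le_of_forall_mem_sphere_norm_le (by positivity) ?_ fun x hx => ?_
    · exact ((hdiff _ (circleMap_mem_sphere c hR θ)).mono
        (closure_ball_subset_closedBall.trans hsub)).diffContOnCl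
    · exact hM (x, circleMap c R θ)
        ⟨hbc (hsub (sphere_subset_closedBall hx)), circleMap_mem_sphere c hR θ⟩
  · exact intervalIntegrable_const
  · refine Eventually.of_forall fun θ _ t ht => ?_
    exact (hda θ t (ball_subset_ball (by linarith) ht)).const_smul _

variable [CompleteSpace E]

/-- Two entire functions that agree near a point are equal. -/
theorem Differentiable.eq_of_eventuallyEq_nhds {f g : ℂ → E} (hf : Differentiable ℂ f)
    (hg : Differentiable ℂ g) {c : ℂ} (h : f =ᶠ[𝓝 c] g) : f = g :=
  AnalyticOnNhd.eq_of_eventuallyEq (fun z _ => hf.analyticAt z) (fun z _ => hg.analyticAt z) h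

/-- An entire function with a finite slope at infinity is affine. -/
theorem Differentiable.eq_add_smul_of_tendsto_cocompact {g : ℂ → E} (hg : Differentiable ℂ g)
    {v : E} (h : Tendsto (fun ζ : ℂ => ζ⁻¹ • (g ζ - g 0)) (cocompact ℂ) (𝓝 v)) (ζ : ℂ) :
    g ζ = g 0 + ζ • v := by
  have hd : Differentiable ℂ (dslope g 0) := by
    rw [← differentiableOn_univ, Complex.differentiableOn_dslope univ_mem]
    exact hg.differentiableOn
  have h0 : ∀ᶠ ζ : ℂ in cocompact ℂ, ζ ≠ 0 := by
    have : ({0} : Set ℂ)ᶜ ∈ cocompact ℂ := isCompact_singleton.compl_mem_cocompact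
    exact this
  have ht : Tendsto (dslope g 0) (cocompact ℂ) (𝓝 v) := by
    refine h.congr' ?_
    filter_upwards [h0] with ζ hζ
    rw [dslope_of_ne _ hζ, slope_def_module, sub_zero]
  have := sub_smul_dslope g 0 ζ
  rw [hd.apply_eq_of_tendsto_cocompact ζ ht, sub_zero] at this
  rw [this]; abel

/-- If `a` is entire and dominated by an entire `b` with at most one zero, it is a multiple
of `b`. -/
theorem exists_eq_smul_of_norm_le {a : ℂ → E} {b : ℂ → ℂ} (ha : Differentiable ℂ a)
    (hb : Differentiable ℂ b) (hab : ∀ t, ‖a t‖ ≤ ‖b t‖) {c : ℂ} (hc : ∀ t, t ≠ c → b t ≠ 0) :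
    ∃ v : E, ∀ t, a t = b t • v := by
  set q : ℂ → E := fun t => (b t)⁻¹ • a t with hq
  have hqd : DifferentiableOn ℂ q (Set.univ \ {c}) := by
    intro t ht
    have : b t ≠ 0 := hc t (by simpa using ht)
    exact (((hb t).inv this).smul (ha t)).differentiableWithinAt
  have hqb : BddAbove (norm ∘ q '' (Set.univ \ {c})) := by
    refine ⟨1, ?_⟩
    rintro _ ⟨t, ht, rfl⟩
    have : b t ≠ 0 := hc t (by simpa using ht)
    simp only [hq, Function.comp_apply, norm_smul, norm_inv]
    rw [inv_mul_le_iff₀ (norm_pos_iff.2 this), mul_one]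
    exact hab t
  have hd := Complex.differentiableOn_update_limUnder_of_bddAbove univ_mem hqd hqb
  rw [differentiableOn_univ] at hd
  -- The quotient a / b with its removable singularity at c filled in; Liouville applies to it.
  set p := Function.update q c (limUnder (𝓝[≠] c) q) with hp
  have hpq : ∀ t, t ≠ c → p t = q t := fun t ht => Function.update_of_ne ht _ _
  have hbdd : Bornology.IsBounded (Set.range p) := by
    refine isBounded_iff_forall_norm_le.2 ⟨max 1 ‖p c‖, ?_⟩
    rintro _ ⟨t, rfl⟩
    by_cases ht : t = c
    · rw [ht]; exact le_max_right _ _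
    · refine le_max_of_le_left ?_
      rw [hpq t ht]
      simp only [hq, norm_smul, norm_inv]
      rw [inv_mul_le_iff₀ (norm_pos_iff.2 (hc t ht)), mul_one]
      exact hab t
  obtain ⟨v, hv⟩ := hd.exists_const_forall_eq_of_bounded hbdd
  refine ⟨v, fun t => ?_⟩
  by_cases ht : t = c
  · have h1 : a = fun t => b t • v := by
      refine ha.continuous.ext_on (s := {c}ᶜ) (dense_compl_singleton c)
        (hb.continuous.smul continuous_const) fun s hs => ?_
      have := (hpq s hs).symm.trans (hv s)
      simp only [hq] at this
      simp only [← this]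
      rw [smul_inv_smul₀ (hc s hs)]
    exact congrFun h1 t
  · have := (hpq t ht).symm.trans (hv t)
    simp only [hq] at this
    rw [← this, smul_inv_smul₀ (hc t ht)]

/-- Conjugating an entire homeomorphism of `ℂ` that fixes `0` by `w ↦ w⁻¹` gives an entire
function. -/
theorem differentiable_inv_comp_inv {h k : ℂ → ℂ} (hh : Differentiable ℂ h)
    (hk : Differentiable ℂ k) (hkh : ∀ t, k (h t) = t) (h0 : h 0 = 0) :
    Differentiable ℂ fun w => (h w⁻¹)⁻¹ := by
  have hne : ∀ w : ℂ, w ≠ 0 → h w ≠ 0 := by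
    intro w hw e
    exact hw ((hkh w).symm.trans ((congrArg k (e.trans h0.symm)).trans (hkh 0)))
  -- h is proper: the preimage of a compact s lies in the compact set k(s).
  have hinf : Tendsto h (cocompact ℂ) (cocompact ℂ) := by
    rw [hasBasis_cocompact.tendsto_right_iff]
    intro s hs
    filter_upwards [(hs.image hk.continuous).compl_mem_cocompact] with t ht hts
    exact ht ⟨h t, hts, hkh t⟩
  have hoff : ∀ w : ℂ, w ≠ 0 → DifferentiableAt ℂ (fun w => (h w⁻¹)⁻¹) w := by
    intro w hw
    exact ((hh w⁻¹).comp w (differentiableAt_inv hw)).inv (hne _ (inv_ne_zero hw))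
  intro w
  by_cases hw : w = 0
  · subst hw
    refine (Complex.analyticAt_of_differentiable_on_punctured_nhds_of_continuousAt ?_
      ?_).differentiableAt
    · filter_upwards [self_mem_nhdsWithin] with w hw using hoff w hw
    · rw [← continuousWithinAt_compl_self, ContinuousWithinAt]
      simp only [inv_zero, h0]
      rw [← Metric.cobounded_eq_cocompact] at hinf
      exact tendsto_inv₀_cobounded.comp (hinf.comp tendsto_inv₀_nhdsNE_zero)
  · exact hoff w hw

/-- An automorphism of `ℂ` that fixes `0` is linear. -/
theorem eq_mul_of_entire_inverse {h k : ℂ → ℂ} (hh : Differentiable ℂ h) (hk : Differentiable ℂ k)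
    (hkh : ∀ t, k (h t) = t) (hhk : ∀ t, h (k t) = t) (h0 : h 0 = 0) (t : ℂ) :
    h t = t * h 1 := by
  have k0 : k 0 = 0 := (congrArg k h0.symm).trans (hkh 0)
  have hφ := differentiable_inv_comp_inv hh hk hkh h0
  have hψ := differentiable_inv_comp_inv hk hh hhk k0
  set φ : ℂ → ℂ := fun w => (h w⁻¹)⁻¹ with hφdef
  set ψ : ℂ → ℂ := fun w => (k w⁻¹)⁻¹ with hψdef
  have φ0 : φ 0 = 0 := by simp [hφdef, h0]
  have hψφ : ψ ∘ φ = id := by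
    funext w; simp [hφdef, hψdef, hkh]
  have hd : deriv φ 0 ≠ 0 := by
    intro e
    have h1 : HasDerivAt (ψ ∘ φ) (deriv ψ (φ 0) * deriv φ 0) 0 :=
      (hψ _).hasDerivAt.comp 0 (hφ 0).hasDerivAt
    rw [hψφ, e, mul_zero] at h1
    exact zero_ne_one (h1.unique (hasDerivAt_id 0))
  have hlim : Tendsto (fun w => w⁻¹ * φ w) (𝓝[≠] 0) (𝓝 (deriv φ 0)) := by
    refine (hasDerivAt_iff_tendsto_slope.1 (hφ 0).hasDerivAt).congr' ?_
    filter_upwards with w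
    rw [slope_def_module, φ0]; simp
  -- With w = ζ⁻¹, the slope h ζ / ζ is the inverse of φ w / w.
  have hlim2 : Tendsto (fun ζ : ℂ => ζ⁻¹ • (h ζ - h 0)) (cocompact ℂ) (𝓝 (deriv φ 0)⁻¹) := by
    rw [← Metric.cobounded_eq_cocompact]
    have hinv : Tendsto (fun ζ : ℂ => ζ⁻¹) (Bornology.cobounded ℂ) (𝓝[≠] 0) :=
      tendsto_inv₀_cobounded'
    refine ((hlim.inv₀ hd).comp hinv).congr fun ζ => ?_
    simp [hφdef, h0, mul_comm]
  have hall := hh.eq_add_smul_of_tendsto_cocompact hlim2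
  have h1 := hall 1
  rw [hall t, h1, h0]; simp

end OneVariable

/-! ### Hartogs extension across the complement -/

section Extension

variable {n : ℕ}

/-- The Hermitian form of signature `(n, 1)` on `ℂ^{n+1}`. -/
noncomputable def lorentzForm (z : Fin (n + 1) → ℂ) : ℝ := -‖z 0‖ ^ 2 + ∑ i : Fin n, ‖z i.succ‖ ^ 2

theorem mem_domainD {z : Fin (n + 1) → ℂ} : z ∈ domainD n ↔ 0 < lorentzForm z := Iff.rfl

theorem mem_domainD_of_norm_lt {z : Fin (n + 1) → ℂ} (i : Fin n) (h : ‖z 0‖ < ‖z i.succ‖) :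
    z ∈ domainD n := by
  rw [mem_domainD, lorentzForm]
  have h1 : ‖z i.succ‖ ^ 2 ≤ ∑ i : Fin n, ‖z i.succ‖ ^ 2 :=
    Finset.single_le_sum (f := fun i : Fin n => ‖z i.succ‖ ^ 2) (fun _ _ => by positivity)
      (Finset.mem_univ i)
  have h2 : ‖z 0‖ ^ 2 < ‖z i.succ‖ ^ 2 := by gcongr
  linarith

theorem update_mem_domainD {z : Fin (n + 1) → ℂ} (i : Fin n) {w : ℂ} (h : ‖z 0‖ < ‖w‖) :
    Function.update z i.succ w ∈ domainD n := by
  refine mem_domainD_of_norm_lt i ?_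
  rwa [Function.update_self, Function.update_of_ne (Fin.succ_ne_zero i).symm]

theorem Differentiable.function_update {ι : Type*} [Fintype ι] [DecidableEq ι] {γ : ℂ → ι → ℂ}
    (hγ : Differentiable ℂ γ) {a : ℂ → ℂ} (ha : Differentiable ℂ a) (i : ι) :
    Differentiable ℂ fun t => Function.update (γ t) i (a t) := by
  rw [differentiable_pi]
  intro j
  by_cases h : j = i
  · subst h; simpa using ha
  · simpa [h] using differentiable_pi.1 hγ j

/-- A map of `ℂ^{n+1}` whose composition with every entire curve is entire. -/
def CurveHolomorphic (Φ : (Fin (n + 1) → ℂ) → (Fin (n + 1) → ℂ)) : Prop :=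
  ∀ γ : ℂ → (Fin (n + 1) → ℂ), Differentiable ℂ γ → Differentiable ℂ fun t => Φ (γ t)

/-- The Hartogs extension, in the variable `i.succ`, of a map given on `domainD n`. -/
noncomputable def hartogsExtension (i : Fin n) (F : (Fin (n + 1) → ℂ) → (Fin (n + 1) → ℂ))
    (z : Fin (n + 1) → ℂ) : Fin (n + 1) → ℂ :=
  (2 * Real.pi * Complex.I : ℂ)⁻¹ • ∮ w in C(0, 1 + ‖z 0‖ + ‖z i.succ‖),
    (w - z i.succ)⁻¹ • F (Function.update z i.succ w)

variable {F : (Fin (n + 1) → ℂ) → (Fin (n + 1) → ℂ)}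

theorem differentiableAt_cauchyKernel_smul
    (hF : DifferentiableOn ℂ F (domainD n : Set (Fin (n + 1) → ℂ)))
    (i : Fin n) {z : Fin (n + 1) → ℂ} {w : ℂ} (h0 : ‖z 0‖ < ‖w‖) (hi : ‖z i.succ‖ < ‖w‖) :
    DifferentiableAt ℂ (fun w => (w - z i.succ)⁻¹ • F (Function.update z i.succ w)) w := by
  have hne : w - z i.succ ≠ 0 := by
    intro e
    rw [sub_eq_zero.1 e] at hi
    exact lt_irrefl _ hi
  have h1 : DifferentiableAt ℂ F (Function.update z i.succ w) :=
    hF.differentiableAt ((domainD n).isOpen.mem_nhds (update_mem_domainD i h0))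
  have h2 : Differentiable ℂ fun w : ℂ => Function.update z i.succ w :=
    (differentiable_const z).function_update differentiable_id i.succ
  have h3 : DifferentiableAt ℂ (fun w => (w - z i.succ)⁻¹) w :=
    (differentiableAt_id.sub_const (z i.succ)).inv hne
  exact h3.smul (h1.comp w h2.differentiableAt)

theorem circleIntegral_cauchyKernel_eq
    (hF : DifferentiableOn ℂ F (domainD n : Set (Fin (n + 1) → ℂ)))
    (i : Fin n) {z : Fin (n + 1) → ℂ} {r R : ℝ} (h0 : ‖z 0‖ < r) (hi : ‖z i.succ‖ < r)
    (hrR : r ≤ R) :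
    (∮ w in C(0, R), (w - z i.succ)⁻¹ • F (Function.update z i.succ w)) =
      ∮ w in C(0, r), (w - z i.succ)⁻¹ • F (Function.update z i.succ w) := by
  refine Complex.circleIntegral_eq_of_differentiable_on_annulus_off_countable
    ((norm_nonneg _).trans_lt h0) hrR Set.countable_empty (fun w hw => ?_) fun w hw => ?_
  · have : r ≤ ‖w‖ := by simpa using hw.2
    exact (differentiableAt_cauchyKernel_smul hF i (h0.trans_le this)
      (hi.trans_le this)).continuousAt.continuousWithinAt
  · have : r < ‖w‖ := by simpa using hw.1.2
    exact differentiableAt_cauchyKernel_smul hF i (h0.trans this) (hi.trans this)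

/-- The radius in `hartogsExtension` varies with z; trading it for a locally constant one is what
allows differentiation under the integral. -/
theorem hartogsExtension_eq
    (hF : DifferentiableOn ℂ F (domainD n : Set (Fin (n + 1) → ℂ)))
    (i : Fin n) {z : Fin (n + 1) → ℂ} {R : ℝ} (h0 : ‖z 0‖ < R) (hi : ‖z i.succ‖ < R) :
    hartogsExtension i F z = (2 * Real.pi * Complex.I : ℂ)⁻¹ • ∮ w in C(0, R),
      (w - z i.succ)⁻¹ • F (Function.update z i.succ w) := by
  rw [hartogsExtension]
  have a := norm_nonneg (z 0)
  have b := norm_nonneg (z i.succ)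
  rcases le_total R (1 + ‖z 0‖ + ‖z i.succ‖) with h | h
  · rw [circleIntegral_cauchyKernel_eq hF i h0 hi h]
  · rw [circleIntegral_cauchyKernel_eq hF i (by linarith) (by linarith) h]

theorem curveHolomorphic_hartogsExtension
    (hF : DifferentiableOn ℂ F (domainD n : Set (Fin (n + 1) → ℂ))) (i : Fin n) :
    CurveHolomorphic (hartogsExtension i F) := by
  intro γ hγ t₀
  set R : ℝ := 1 + ‖γ t₀ 0‖ + ‖γ t₀ i.succ‖ with hR
  have a := norm_nonneg (γ t₀ 0)
  have b := norm_nonneg (γ t₀ i.succ)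
  have hc : ∀ j, Continuous fun t => γ t j := fun j => (differentiable_pi.1 hγ j).continuous
  have hnear : ∀ᶠ t in 𝓝 t₀, ‖γ t 0‖ < R ∧ ‖γ t i.succ‖ < R :=
    ((hc 0).norm.continuousAt.eventually_lt continuousAt_const (by simp only [hR]; linarith)).and
      ((hc i.succ).norm.continuousAt.eventually_lt continuousAt_const (by simp only [hR]; linarith))
  obtain ⟨ε, hε, hball⟩ := nhds_basis_closedBall.eventually_iff.1 hnear
  have hsph : ∀ w ∈ sphere (0 : ℂ) R, ‖w‖ = R := fun w hw => by simpa using hw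
  have hint : DifferentiableAt ℂ (fun t => ∮ w in C(0, R),
      (w - γ t i.succ)⁻¹ • F (Function.update (γ t) i.succ w)) t₀ := by
    have hmem : ∀ t ∈ closedBall t₀ ε, ∀ w ∈ sphere (0 : ℂ) R,
        Function.update (γ t) i.succ w ∈ domainD n := fun t ht w hw =>
      update_mem_domainD i (by rw [hsph w hw]; exact (hball ht).1)
    have hne : ∀ t ∈ closedBall t₀ ε, ∀ w ∈ sphere (0 : ℂ) R, w - γ t i.succ ≠ 0 := by
      intro t ht w hw e
      have := (hball ht).2
      rw [← sub_eq_zero.1 e, hsph w hw] at this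
      exact lt_irrefl _ this
    have hcont : ContinuousOn (fun p : ℂ × ℂ => (p.2 - γ p.1 i.succ)⁻¹ •
        F (Function.update (γ p.1) i.succ p.2)) (closedBall t₀ ε ×ˢ sphere 0 R) := by
      have h1 : ContinuousOn (fun p : ℂ × ℂ => p.2 - γ p.1 i.succ)
          (closedBall t₀ ε ×ˢ sphere 0 R) :=
        (continuous_snd.sub ((hc i.succ).comp continuous_fst)).continuousOn
      refine (h1.inv₀ fun p hp => hne p.1 hp.1 p.2 hp.2).smul ?_
      · refine hF.continuousOn.comp (f := fun p : ℂ × ℂ => Function.update (γ p.1) i.succ p.2) ?_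
          fun p hp => hmem p.1 hp.1 p.2 hp.2
        exact ((hγ.continuous.comp continuous_fst).update i.succ continuous_snd).continuousOn
    refine differentiableAt_circleIntegral_of_continuousOn hε (by positivity) hcont fun w hw => ?_
    · intro t ht
      have ht' := ball_subset_closedBall ht
      have h1 : DifferentiableAt ℂ F (Function.update (γ t) i.succ w) :=
        hF.differentiableAt ((domainD n).isOpen.mem_nhds (hmem t ht' w hw))
      have h2 := hγ.function_update (differentiable_const w) i.succ
      exact ((((differentiable_pi.1 hγ i.succ t).const_sub w).inv (hne t ht' w hw)).smul
        (h1.comp t h2.differentiableAt)).differentiableWithinAt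
  refine (hint.const_smul (2 * Real.pi * Complex.I : ℂ)⁻¹).congr_of_eventuallyEq ?_
  filter_upwards [hnear] with t ht
  exact hartogsExtension_eq hF i ht.1 ht.2

/-- When a coordinate other than the i-th already dominates z 0, the whole complex line in the i-th
direction lies in the domain, and Cauchy's formula applies. -/
theorem hartogsExtension_eq_of_norm_lt
    (hF : DifferentiableOn ℂ F (domainD n : Set (Fin (n + 1) → ℂ)))
    {i j : Fin n} (hij : j ≠ i) {z : Fin (n + 1) → ℂ} (h : ‖z 0‖ < ‖z j.succ‖) :
    hartogsExtension i F z = F z := by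
  have hd : Differentiable ℂ fun w : ℂ => F (Function.update z i.succ w) := by
    intro w
    have hmem : Function.update z i.succ w ∈ domainD n := by
      refine mem_domainD_of_norm_lt j ?_
      rwa [Function.update_of_ne (Fin.succ_ne_zero i).symm,
        Function.update_of_ne fun e => hij (Fin.succ_injective _ e)]
    exact (hF.differentiableAt ((domainD n).isOpen.mem_nhds hmem)).comp w
      ((differentiable_const z).function_update differentiable_id i.succ).differentiableAt
  have := Complex.two_pi_I_inv_smul_circleIntegral_sub_inv_smul_of_differentiable_on_off_countable
    (c := 0) (R := 1 + ‖z 0‖ + ‖z i.succ‖) (w := z i.succ) Set.countable_empty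
    (by rw [mem_ball_zero_iff]; linarith [norm_nonneg (z 0)]) hd.continuous.continuousOn
    fun x _ => hd x
  rw [hartogsExtension, this, Function.update_eq_self]

/-- Shrinking z 0 to ζ * z 0 with ‖ζ‖ ≤ 1 stays in the domain and, for small ζ, reaches the region
where z j dominates. The identity theorem carries the equality back to ζ = 1. -/
theorem eq_hartogsExtension_of_ne_zero
    (hF : DifferentiableOn ℂ F (domainD n : Set (Fin (n + 1) → ℂ)))
    {i j : Fin n} (hij : j ≠ i) {z : Fin (n + 1) → ℂ} (hz : z ∈ domainD n) (hj : z j.succ ≠ 0) :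
    hartogsExtension i F z = F z := by
  set γ : ℂ → Fin (n + 1) → ℂ := fun ζ => Function.update z 0 (ζ * z 0) with hγdef
  have hγ : Differentiable ℂ γ :=
    (differentiable_const z).function_update (differentiable_id.mul_const (z 0)) 0
  have hγ1 : γ 1 = z := by simp [hγdef]
  have hγj : ∀ ζ, γ ζ j.succ = z j.succ := fun ζ => Function.update_of_ne (Fin.succ_ne_zero j) _ _
  have hmem : ∀ ζ ∈ closedBall (0 : ℂ) 1, γ ζ ∈ domainD n := by
    intro ζ hζ
    rw [mem_closedBall_zero_iff] at hζ
    rw [mem_domainD, lorentzForm] at hz ⊢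
    have : ‖γ ζ 0‖ ^ 2 ≤ ‖z 0‖ ^ 2 := by
      simp only [hγdef, Function.update_self, norm_mul]
      gcongr
      exact mul_le_of_le_one_left (norm_nonneg _) hζ
    have h2 : ∀ k : Fin n, γ ζ k.succ = z k.succ := fun k =>
      Function.update_of_ne (Fin.succ_ne_zero k) _ _
    simp only [h2]
    linarith
  have hop : IsOpen (γ ⁻¹' (domainD n : Set (Fin (n + 1) → ℂ))) :=
    (domainD n).isOpen.preimage hγ.continuous
  have hFγ : DifferentiableOn ℂ (fun ζ => F (γ ζ)) (γ ⁻¹' (domainD n : Set (Fin (n + 1) → ℂ))) :=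
    hF.comp hγ.differentiableOn fun _ h => h
  have hHγ := curveHolomorphic_hartogsExtension hF i γ hγ
  have key : Set.EqOn (fun ζ => hartogsExtension i F (γ ζ)) (fun ζ => F (γ ζ))
      (closedBall 0 1) := by
    refine AnalyticOnNhd.eqOn_of_preconnected_of_eventuallyEq (z₀ := 0)
      (fun ζ _ => hHγ.analyticAt ζ) (fun ζ hζ => hFγ.analyticAt (hop.mem_nhds (hmem ζ hζ)))
      (convex_closedBall _ _).isPreconnected (mem_closedBall_self zero_le_one) ?_
    have hc0 : Continuous fun ζ => ‖γ ζ 0‖ := (differentiable_pi.1 hγ 0).continuous.norm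
    have : ∀ᶠ ζ in 𝓝 (0 : ℂ), ‖γ ζ 0‖ < ‖z j.succ‖ := by
      refine hc0.continuousAt.eventually_lt continuousAt_const ?_
      simpa [hγdef] using hj
    filter_upwards [this] with ζ hζ
    exact hartogsExtension_eq_of_norm_lt hF hij (by rwa [hγj])
  have := key (x := 1) (by simp)
  simpa only [hγ1] using this

/-- The Hartogs extension extends the given map. -/
theorem hartogsExtension_eq_of_mem
    (hF : DifferentiableOn ℂ F (domainD n : Set (Fin (n + 1) → ℂ)))
    {i j : Fin n} (hij : j ≠ i) {z : Fin (n + 1) → ℂ} (hz : z ∈ domainD n) :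
    hartogsExtension i F z = F z := by
  by_cases hj : z j.succ = 0
  -- Perturb the vanishing coordinate and pass to the limit.
  · set γ : ℂ → Fin (n + 1) → ℂ := fun ζ => Function.update z j.succ ζ with hγdef
    have hγ : Differentiable ℂ γ :=
      (differentiable_const z).function_update differentiable_id j.succ
    have hγ0 : γ 0 = z := by simp [hγdef, ← hj]
    have hz0 : γ 0 ∈ domainD n := by rwa [hγ0]
    have h1 : Tendsto (fun ζ => hartogsExtension i F (γ ζ)) (𝓝[≠] 0)
        (𝓝 (hartogsExtension i F (γ 0))) :=
      (curveHolomorphic_hartogsExtension hF i γ hγ).continuous.continuousAt.mono_left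
        nhdsWithin_le_nhds
    have h2 : Tendsto (fun ζ => F (γ ζ)) (𝓝[≠] 0) (𝓝 (F (γ 0))) := by
      have : ContinuousAt (fun ζ => F (γ ζ)) 0 :=
        (hF.continuousOn.continuousAt ((domainD n).isOpen.mem_nhds hz0)).comp (f := γ)
          hγ.continuous.continuousAt
      exact this.mono_left nhdsWithin_le_nhds
    have hev : ∀ᶠ ζ in 𝓝[≠] (0 : ℂ), γ ζ ∈ domainD n :=
      nhdsWithin_le_nhds (hγ.continuous.continuousAt.preimage_mem_nhds
        ((domainD n).isOpen.mem_nhds hz0))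
    have := tendsto_nhds_unique_of_eventuallyEq h1 h2 (by
      filter_upwards [hev, self_mem_nhdsWithin] with ζ hζ hne
      exact eq_hartogsExtension_of_ne_zero hF hij hζ (by simpa [hγdef] using hne))
    rwa [hγ0] at this
  · exact eq_hartogsExtension_of_ne_zero hF hij hz hj

end Extension

/-! ### Linearity of automorphisms -/

section Rigidity

variable {n : ℕ}

theorem lorentzForm_smul (c : ℂ) (z : Fin (n + 1) → ℂ) :
    lorentzForm (c • z) = ‖c‖ ^ 2 * lorentzForm z := by
  simp only [lorentzForm, Pi.smul_apply, smul_eq_mul, norm_mul, mul_pow, ← Finset.mul_sum]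
  ring

theorem continuous_lorentzForm : Continuous (lorentzForm : (Fin (n + 1) → ℂ) → ℝ) := by
  unfold lorentzForm
  fun_prop

theorem norm_le_norm_apply_zero {z : Fin (n + 1) → ℂ} (hz : lorentzForm z ≤ 0) :
    ‖z‖ ≤ ‖z 0‖ := by
  refine (pi_norm_le_iff_of_nonneg (norm_nonneg _)).2 fun j => ?_
  refine Fin.cases le_rfl (fun i => ?_) j
  by_contra! h
  exact absurd (mem_domainD.1 (mem_domainD_of_norm_lt i h)) hz.not_gt

theorem lorentzForm_single_zero : lorentzForm (Pi.single 0 1 : Fin (n + 1) → ℂ) = -1 := by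
  simp [lorentzForm]

theorem lorentzForm_single_add_single (i : Fin n) :
    lorentzForm (Pi.single 0 1 + Pi.single i.succ 1 : Fin (n + 1) → ℂ) = 0 := by
  have h : ∀ k : Fin n, ‖(Pi.single 0 1 + Pi.single i.succ 1 : Fin (n + 1) → ℂ) k.succ‖ ^ 2 =
      if k = i then 1 else 0 := by
    intro k
    by_cases hk : k = i
    · subst hk; simp
    · simp [hk]
  rw [lorentzForm, Finset.sum_congr rfl fun k _ => h k]
  simp [(Fin.succ_ne_zero i).symm]

variable {Φ Ψ : (Fin (n + 1) → ℂ) → (Fin (n + 1) → ℂ)}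

/-- The curve t ↦ Φ (t • u) stays in the nonpositive cone, so its zeroth coordinate dominates it. A
zero of that coordinate is a zero of the curve, and injectivity allows at most one;
`exists_eq_smul_of_norm_le` then applies. -/
theorem CurveHolomorphic.exists_eq_smul (hΦ : CurveHolomorphic Φ) (hinj : Function.Injective Φ)
    (hneg : ∀ z, lorentzForm z ≤ 0 → lorentzForm (Φ z) ≤ 0) {u : Fin (n + 1) → ℂ}
    (hu : lorentzForm u ≤ 0) (hu0 : u ≠ 0) :
    ∃ v : Fin (n + 1) → ℂ, v ≠ 0 ∧ lorentzForm v ≤ 0 ∧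
      ∃ h : ℂ → ℂ, Differentiable ℂ h ∧ ∀ t : ℂ, Φ (t • u) = h t • v := by
  have ha : Differentiable ℂ fun t : ℂ => Φ (t • u) :=
    hΦ _ (differentiable_id.smul_const u)
  have hb : Differentiable ℂ fun t : ℂ => Φ (t • u) 0 := differentiable_pi.1 ha 0
  have hQ : ∀ t : ℂ, lorentzForm (Φ (t • u)) ≤ 0 := fun t => hneg _ (by
    rw [lorentzForm_smul]; exact mul_nonpos_of_nonneg_of_nonpos (by positivity) hu)
  have hab : ∀ t : ℂ, ‖Φ (t • u)‖ ≤ ‖Φ (t • u) 0‖ := fun t => norm_le_norm_apply_zero (hQ t)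
  have hzero : ∀ t : ℂ, Φ (t • u) 0 = 0 → Φ (t • u) = 0 := fun t ht => by
    simpa [ht] using hab t
  obtain ⟨c, hc⟩ : ∃ c : ℂ, ∀ t, t ≠ c → Φ (t • u) 0 ≠ 0 := by
    by_cases hex : ∃ c : ℂ, Φ (c • u) 0 = 0
    · obtain ⟨c, hc⟩ := hex
      refine ⟨c, fun t htc ht => htc ?_⟩
      exact smul_left_injective ℂ hu0 (hinj ((hzero t ht).trans (hzero c hc).symm))
    · push Not at hex
      exact ⟨0, fun t _ => hex t⟩
  obtain ⟨v, hv⟩ := exists_eq_smul_of_norm_le ha hb hab hc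
  have hne := hc (c + 1) (by simp)
  refine ⟨v, ?_, ?_, _, hb, hv⟩
  · rintro rfl
    apply hne
    rw [hv (c + 1)]
    simp
  · have := hQ (c + 1)
    rw [hv (c + 1), lorentzForm_smul] at this
    by_contra! hcon
    exact this.not_gt (mul_pos (by positivity) hcon)

theorem CurveHolomorphic.exists_eq_smul_of_inverse (hΦ : CurveHolomorphic Φ)
    (hΨ : CurveHolomorphic Ψ) (hΨΦ : ∀ z, Ψ (Φ z) = z) (hΦΨ : ∀ z, Φ (Ψ z) = z)
    (hΦneg : ∀ z, lorentzForm z ≤ 0 → lorentzForm (Φ z) ≤ 0)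
    (hΨneg : ∀ z, lorentzForm z ≤ 0 → lorentzForm (Ψ z) ≤ 0) {u : Fin (n + 1) → ℂ}
    (hu : lorentzForm u ≤ 0) (hu0 : u ≠ 0) :
    ∃ v : Fin (n + 1) → ℂ, v ≠ 0 ∧ ∃ h k : ℂ → ℂ, Differentiable ℂ h ∧ Differentiable ℂ k ∧
      (∀ t : ℂ, Φ (t • u) = h t • v) ∧ ∀ s : ℂ, Ψ (s • v) = k s • u := by
  obtain ⟨v, hv0, hv, h, hh, hhv⟩ :=
    hΦ.exists_eq_smul (Function.LeftInverse.injective hΨΦ) hΦneg hu hu0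
  obtain ⟨w, -, -, k, hk, hkw⟩ :=
    hΨ.exists_eq_smul (Function.LeftInverse.injective hΦΨ) hΨneg hv hv0
  have h1 : u = k (h 1) • w := by
    rw [← hkw, ← hhv, one_smul, hΨΦ]
  have hne : k (h 1) ≠ 0 := by
    intro e
    rw [e, zero_smul] at h1
    exact hu0 h1
  refine ⟨v, hv0, h, fun s => k s * (k (h 1))⁻¹, hh, hk.mul_const _, hhv, fun s => ?_⟩
  rw [hkw, mul_smul]
  congr 1
  rw [eq_inv_smul_iff₀ hne, ← h1]

/-- Ψ 0 lies on every complex line of the nonpositive cone, and two distinct lines meet only at 0.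
-/
theorem CurveHolomorphic.map_zero_of_inverse (i : Fin n) (hΦ : CurveHolomorphic Φ)
    (hΨ : CurveHolomorphic Ψ) (hΨΦ : ∀ z, Ψ (Φ z) = z) (hΦΨ : ∀ z, Φ (Ψ z) = z)
    (hΦneg : ∀ z, lorentzForm z ≤ 0 → lorentzForm (Φ z) ≤ 0)
    (hΨneg : ∀ z, lorentzForm z ≤ 0 → lorentzForm (Ψ z) ≤ 0) : Ψ 0 = 0 := by
  have hspan : ∀ u : Fin (n + 1) → ℂ, lorentzForm u ≤ 0 → u ≠ 0 → ∃ c : ℂ, Ψ 0 = c • u := by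
    intro u hu hu0
    obtain ⟨v, -, h, k, -, -, -, hk⟩ :=
      hΦ.exists_eq_smul_of_inverse hΨ hΨΦ hΦΨ hΦneg hΨneg hu hu0
    exact ⟨k 0, by rw [← hk, zero_smul]⟩
  obtain ⟨a, ha⟩ := hspan (Pi.single 0 1) (by rw [lorentzForm_single_zero]; norm_num)
    (by simp)
  obtain ⟨b, hb⟩ := hspan (Pi.single 0 1 + Pi.single i.succ 1)
    (lorentzForm_single_add_single i).le fun e => by
      simpa [Pi.single_apply, (Fin.succ_ne_zero i).symm] using congrFun e 0
  have h1 : b = 0 := by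
    have := congrFun (ha.symm.trans hb) i.succ
    simpa using this.symm
  rw [hb, h1, zero_smul]

theorem CurveHolomorphic.map_smul_of_nonpos (i : Fin n) (hΦ : CurveHolomorphic Φ)
    (hΨ : CurveHolomorphic Ψ) (hΨΦ : ∀ z, Ψ (Φ z) = z) (hΦΨ : ∀ z, Φ (Ψ z) = z)
    (hΦneg : ∀ z, lorentzForm z ≤ 0 → lorentzForm (Φ z) ≤ 0)
    (hΨneg : ∀ z, lorentzForm z ≤ 0 → lorentzForm (Ψ z) ≤ 0) {u : Fin (n + 1) → ℂ}
    (hu : lorentzForm u ≤ 0) (t : ℂ) : Φ (t • u) = t • Φ u := by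
  have hΦ0 : Φ 0 = 0 := hΨ.map_zero_of_inverse i hΦ hΦΨ hΨΦ hΨneg hΦneg
  by_cases hu0 : u = 0
  · simp [hu0, hΦ0]
  obtain ⟨v, hv0, h, k, hh, hk, hhv, hku⟩ :=
    hΦ.exists_eq_smul_of_inverse hΨ hΨΦ hΦΨ hΦneg hΨneg hu hu0
  have hkh : ∀ t, k (h t) = t := fun t => smul_left_injective ℂ hu0 (by
    simp only; rw [← hku, ← hhv, hΨΦ])
  have hhk : ∀ t, h (k t) = t := fun t => smul_left_injective ℂ hv0 (by
    simp only; rw [← hhv, ← hku, hΦΨ])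
  have h0 : h 0 = 0 := smul_left_injective ℂ hv0 (by
    simp only; rw [← hhv, zero_smul, zero_smul, hΦ0])
  have h1 := hhv 1
  rw [one_smul] at h1
  rw [hhv, eq_mul_of_entire_inverse hh hk hkh hhk h0 t, mul_smul, ← h1]

theorem CurveHolomorphic.map_smul_of_inverse (i : Fin n) (hΦ : CurveHolomorphic Φ)
    (hΨ : CurveHolomorphic Ψ) (hΨΦ : ∀ z, Ψ (Φ z) = z) (hΦΨ : ∀ z, Φ (Ψ z) = z)
    (hΦneg : ∀ z, lorentzForm z ≤ 0 → lorentzForm (Φ z) ≤ 0)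
    (hΨneg : ∀ z, lorentzForm z ≤ 0 → lorentzForm (Ψ z) ≤ 0) (t : ℂ) (z : Fin (n + 1) → ℂ) :
    Φ (t • z) = t • Φ z := by
  set e : Fin (n + 1) → ℂ := Pi.single 0 1 with he
  -- A complex line from the open negative cone to z: homogeneity holds near s = 0, hence at s = 1.
  set γ : ℂ → Fin (n + 1) → ℂ := fun s => e + s • (z - e) with hγdef
  have hγ : Differentiable ℂ γ := (differentiable_id.smul_const (z - e)).const_add e
  have hev : ∀ᶠ s in 𝓝 (0 : ℂ), lorentzForm (γ s) < 0 := by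
    refine (continuous_lorentzForm.comp hγ.continuous).continuousAt.eventually_lt
      continuousAt_const ?_
    simp only [Function.comp_apply, hγdef, zero_smul, add_zero, he, lorentzForm_single_zero]
    norm_num
  have hd1 : Differentiable ℂ fun s => Φ (t • γ s) := hΦ _ (hγ.const_smul t)
  have hd2 : Differentiable ℂ fun s => t • Φ (γ s) := (hΦ _ hγ).const_smul t
  have := congrFun (hd1.eq_of_eventuallyEq_nhds hd2 (c := 0) (by
    filter_upwards [hev] with s hs
    exact hΦ.map_smul_of_nonpos i hΨ hΨΦ hΦΨ hΦneg hΨneg hs.le t)) 1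
  simpa [hγdef] using this

/-- A homogeneous holomorphic map is additive. -/
theorem CurveHolomorphic.map_add_of_map_smul (hΦ : CurveHolomorphic Φ)
    (hsmul : ∀ (t : ℂ) z, Φ (t • z) = t • Φ z) (x y : Fin (n + 1) → ℂ) :
    Φ (x + y) = Φ x + Φ y := by
  have hd : Differentiable ℂ fun ζ : ℂ => Φ (x + ζ • y) :=
    hΦ _ ((differentiable_id.smul_const y).const_add x)
  have hd' : Differentiable ℂ fun ζ : ℂ => Φ (ζ • x + y) :=
    hΦ _ ((differentiable_id.smul_const x).add_const y)
  have hinv : Tendsto (fun ζ : ℂ => ζ⁻¹) (cocompact ℂ) (𝓝 0) := by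
    rw [← Metric.cobounded_eq_cocompact]
    exact tendsto_inv₀_cobounded
  -- By homogeneity ζ⁻¹ • Φ (x + ζ • y) = Φ (ζ⁻¹ • x + y), which tends to Φ y; so Φ is affine along
  -- the line.
  have hlim : Tendsto (fun ζ : ℂ => ζ⁻¹ • (Φ (x + ζ • y) - Φ (x + (0 : ℂ) • y))) (cocompact ℂ)
      (𝓝 (Φ y)) := by
    have h1 : Tendsto (fun ζ : ℂ => Φ (ζ⁻¹ • x + y) - ζ⁻¹ • Φ x) (cocompact ℂ)
        (𝓝 (Φ ((0 : ℂ) • x + y) - (0 : ℂ) • Φ x)) :=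
      ((hd'.continuous.tendsto 0).comp hinv).sub (hinv.smul_const _)
    rw [zero_smul, zero_add, zero_smul, sub_zero] at h1
    refine h1.congr' ?_
    have h0 : ({0} : Set ℂ)ᶜ ∈ cocompact ℂ := isCompact_singleton.compl_mem_cocompact
    filter_upwards [h0] with ζ hζ
    rw [zero_smul, add_zero, smul_sub, ← hsmul _ (x + ζ • y), smul_add, inv_smul_smul₀ hζ]
  have := hd.eq_add_smul_of_tendsto_cocompact hlim 1
  simpa using this

variable {f g : (Fin (n + 1) → ℂ) → (Fin (n + 1) → ℂ)}

/-- The identity theorem along the complex line joining a point of the domain to z. -/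
theorem hartogsExtension_leftInverse {i j : Fin n} (hij : j ≠ i)
    (hf : DifferentiableOn ℂ f (domainD n : Set (Fin (n + 1) → ℂ)))
    (hg : DifferentiableOn ℂ g (domainD n : Set (Fin (n + 1) → ℂ)))
    (hfD : ∀ z ∈ domainD n, f z ∈ domainD n) (hgf : ∀ z ∈ domainD n, g (f z) = z)
    (z : Fin (n + 1) → ℂ) :
    hartogsExtension i g (hartogsExtension i f z) = z := by
  set p : Fin (n + 1) → ℂ := Pi.single i.succ 1 with hp
  have hpD : p ∈ domainD n := mem_domainD_of_norm_lt i (by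
    simp [hp, (Fin.succ_ne_zero i).symm])
  set γ : ℂ → Fin (n + 1) → ℂ := fun s => p + s • (z - p) with hγdef
  have hγ : Differentiable ℂ γ := (differentiable_id.smul_const (z - p)).const_add p
  have hγ0 : γ 0 = p := by simp [hγdef]
  have hev : ∀ᶠ s in 𝓝 (0 : ℂ), γ s ∈ domainD n :=
    hγ.continuous.continuousAt.preimage_mem_nhds ((domainD n).isOpen.mem_nhds (by rwa [hγ0]))
  have hd := curveHolomorphic_hartogsExtension hg i _
    (curveHolomorphic_hartogsExtension hf i γ hγ)
  have := congrFun (hd.eq_of_eventuallyEq_nhds hγ (c := 0) (by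
    filter_upwards [hev] with s hs
    rw [hartogsExtension_eq_of_mem hf hij hs, hartogsExtension_eq_of_mem hg hij (hfD _ hs),
      hgf _ hs])) 1
  simpa [hγdef] using this

/-- For `n > 1`, every automorphism of `domainD n` is the restriction of a linear map that
preserves the domain and its complement. -/
theorem exists_linearMap_of_holAut (hn : 1 < n) (φ : HolAut (domainD n)) :
    ∃ A : (Fin (n + 1) → ℂ) →ₗ[ℂ] (Fin (n + 1) → ℂ),
      (∀ z : domainD n, A z = ((φ : domainD n ≃ₜ domainD n) z : Fin (n + 1) → ℂ)) ∧
      ∀ z, A z ∈ domainD n ↔ z ∈ domainD n := by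
  obtain ⟨⟨f, hf, hfφ⟩, ⟨g, hg, hgφ⟩⟩ := φ.2
  set i : Fin n := ⟨0, by omega⟩
  have hij : (⟨1, hn⟩ : Fin n) ≠ i := by simp [i]
  have hfD : ∀ z ∈ domainD n, f z ∈ domainD n := fun z hz => by
    rw [hfφ ⟨z, hz⟩]; exact Subtype.property _
  have hgD : ∀ z ∈ domainD n, g z ∈ domainD n := fun z hz => by
    rw [hgφ ⟨z, hz⟩]; exact Subtype.property _
  have hgf : ∀ z ∈ domainD n, g (f z) = z := fun z hz => by
    rw [hfφ ⟨z, hz⟩, hgφ, Homeomorph.symm_apply_apply]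
  have hfg : ∀ z ∈ domainD n, f (g z) = z := fun z hz => by
    rw [hgφ ⟨z, hz⟩, hfφ, Homeomorph.apply_symm_apply]
  set Φ := hartogsExtension i f
  set Ψ := hartogsExtension i g
  have hΦf : ∀ z ∈ domainD n, Φ z = f z := fun z hz => hartogsExtension_eq_of_mem hf hij hz
  have hΨg : ∀ z ∈ domainD n, Ψ z = g z := fun z hz => hartogsExtension_eq_of_mem hg hij hz
  have hΨΦ : ∀ z, Ψ (Φ z) = z := hartogsExtension_leftInverse hij hf hg hfD hgf
  have hΦΨ : ∀ z, Φ (Ψ z) = z := hartogsExtension_leftInverse hij hg hf hgD hfg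
  have hΦD : ∀ z, Φ z ∈ domainD n ↔ z ∈ domainD n := fun z =>
    ⟨fun h => by rw [← hΨΦ z, hΨg _ h]; exact hgD _ h, fun h => by rw [hΦf z h]; exact hfD z h⟩
  have hΨD : ∀ z, Ψ z ∈ domainD n ↔ z ∈ domainD n := fun z => by
    rw [← hΦD (Ψ z), hΦΨ]
  have hΦneg : ∀ z, lorentzForm z ≤ 0 → lorentzForm (Φ z) ≤ 0 := fun z hz =>
    not_lt.1 fun h => ((hΦD z).1 h).not_ge hz
  have hΨneg : ∀ z, lorentzForm z ≤ 0 → lorentzForm (Ψ z) ≤ 0 := fun z hz =>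
    not_lt.1 fun h => ((hΨD z).1 h).not_ge hz
  have hΦ : CurveHolomorphic Φ := curveHolomorphic_hartogsExtension hf i
  have hsmul := hΦ.map_smul_of_inverse i (curveHolomorphic_hartogsExtension hg i) hΨΦ hΦΨ
    hΦneg hΨneg
  exact ⟨⟨⟨Φ, hΦ.map_add_of_map_smul hsmul⟩, hsmul⟩,
    fun z => (hΦf z z.2).trans (hfφ z), hΦD⟩

end Rigidity

/-! ### Linear maps preserving the positive cone -/

section Conformal

variable {n : ℕ}

/-- Only the quadratic shape in real t is needed later; the cross term B stays anonymous. -/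
theorem exists_lorentzForm_add_smul (x y : Fin (n + 1) → ℂ) :
    ∃ B : ℝ, ∀ t : ℝ, lorentzForm (x + (t : ℂ) • y) =
      lorentzForm x + t * B + t ^ 2 * lorentzForm y := by
  refine ⟨-(2 * inner ℝ (x 0) (y 0)) + ∑ i : Fin n, 2 * inner ℝ (x i.succ) (y i.succ),
    fun t => ?_⟩
  have h : ∀ a b : ℂ, ‖a + (t : ℂ) * b‖ ^ 2 =
      ‖a‖ ^ 2 + t * (2 * inner ℝ a b) + t ^ 2 * ‖b‖ ^ 2 := by
    intro a b
    have : (t : ℂ) * b = t • b := by simp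
    rw [this, norm_add_sq_real, inner_smul_right, norm_smul, Real.norm_eq_abs, mul_pow, sq_abs]
    ring
  simp only [lorentzForm, Pi.add_apply, Pi.smul_apply, smul_eq_mul, h, Finset.sum_add_distrib,
    ← Finset.mul_sum]
  ring

/-- If a quadratic polynomial with distinct real roots vanishes wherever
`c + t * b + t ^ 2 * a` does, where `c < 0 < a`, the outer coefficients are proportional. -/
theorem mul_eq_mul_of_quadratic_roots {a b c a' b' c' : ℝ} (ha : 0 < a) (hc : c < 0)
    (h : ∀ t : ℝ, c + t * b + t ^ 2 * a = 0 → c' + t * b' + t ^ 2 * a' = 0) :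
    c' * a = c * a' := by
  have hdisc : 0 < b ^ 2 - 4 * a * c := by nlinarith [sq_nonneg b, mul_pos ha (neg_pos.2 hc)]
  set s := Real.sqrt (b ^ 2 - 4 * a * c) with hs
  have hs0 : 0 < s := Real.sqrt_pos.2 hdisc
  have hs2 : s ^ 2 = b ^ 2 - 4 * a * c := Real.sq_sqrt hdisc.le
  have e1 := h ((-b + s) / (2 * a)) (by field_simp; linear_combination hs2)
  have e2 := h ((-b - s) / (2 * a)) (by field_simp; linear_combination hs2)
  set t₁ := (-b + s) / (2 * a) with ht1
  set t₂ := (-b - s) / (2 * a) with ht2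
  have hsub : t₁ - t₂ ≠ 0 := by
    have : t₁ - t₂ = s / a := by rw [ht1, ht2]; field_simp; ring
    rw [this]; positivity
  have hprod : t₁ * t₂ * a = c := by
    rw [ht1, ht2]; field_simp; linear_combination -hs2
  -- Eliminate b' between the two root equations and cancel t₁ - t₂.
  have hc' : c' = t₁ * t₂ * a' :=
    mul_left_cancel₀ hsub (by linear_combination t₁ * e2 - t₂ * e1)
  rw [hc', ← hprod]; ring

variable {A : (Fin (n + 1) → ℂ) →ₗ[ℂ] (Fin (n + 1) → ℂ)}

theorem lorentzForm_single_succ (i : Fin n) :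
    lorentzForm (Pi.single i.succ 1 : Fin (n + 1) → ℂ) = 1 := by
  have h : ∀ k : Fin n, ‖(Pi.single i.succ 1 : Fin (n + 1) → ℂ) k.succ‖ ^ 2 =
      if k = i then 1 else 0 := by
    intro k
    by_cases hk : k = i
    · subst hk; simp
    · simp [hk]
  rw [lorentzForm, Finset.sum_congr rfl fun k _ => h k]
  simp [(Fin.succ_ne_zero i).symm]

/-- A null vector is a limit of positive vectors z + t y as t ↓ 0, with the sign of y chosen to make
the cross term nonnegative. Their images are positive, so the limit is at least 0; the opposite
inequality comes from the complement. -/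
theorem lorentzForm_map_eq_zero (hA : ∀ z, A z ∈ domainD n ↔ z ∈ domainD n) (i : Fin n)
    {z : Fin (n + 1) → ℂ} (hz : lorentzForm z = 0) : lorentzForm (A z) = 0 := by
  refine le_antisymm (not_lt.1 fun h => ((hA z).1 h).ne' hz) ?_
  obtain ⟨y, hy, B, hB0, hB⟩ : ∃ y : Fin (n + 1) → ℂ, 0 < lorentzForm y ∧ ∃ B : ℝ, 0 ≤ B ∧
      ∀ t : ℝ, lorentzForm (z + (t : ℂ) • y) = lorentzForm z + t * B + t ^ 2 * lorentzForm y := by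
    set p : Fin (n + 1) → ℂ := Pi.single i.succ 1 with hp
    have hp1 : lorentzForm p = 1 := lorentzForm_single_succ i
    obtain ⟨B, hB⟩ := exists_lorentzForm_add_smul z p
    rcases le_total 0 B with h | h
    · exact ⟨p, by rw [hp1]; exact one_pos, B, h, hB⟩
    · have hp' : lorentzForm (-p) = 1 := by
        rw [← neg_one_smul ℂ, lorentzForm_smul, hp1]; simp
      refine ⟨-p, by rw [hp']; exact one_pos, -B, by linarith, fun t => ?_⟩
      have := hB (-t)
      rw [Complex.ofReal_neg, neg_smul, ← smul_neg] at this
      rw [this, hp', hp1]; ring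
  obtain ⟨B', hB'⟩ := exists_lorentzForm_add_smul (A z) (A y)
  have hcont : Continuous fun t : ℝ =>
      lorentzForm (A z) + t * B' + t ^ 2 * lorentzForm (A y) := by fun_prop
  have hlim : Tendsto (fun t : ℝ => lorentzForm (A z) + t * B' + t ^ 2 * lorentzForm (A y))
      (𝓝[>] 0) (𝓝 (lorentzForm (A z))) := by
    have := (hcont.tendsto 0).mono_left (nhdsWithin_le_nhds (s := Set.Ioi (0 : ℝ)))
    simpa using this
  refine ge_of_tendsto hlim ?_
  filter_upwards [self_mem_nhdsWithin] with t ht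
  have ht : 0 < t := ht
  rw [← hB', ← map_smul, ← map_add]
  refine (mem_domainD.1 ((hA _).2 ?_)).le
  rw [mem_domainD, hB, hz]
  positivity

/-- A linear map that preserves the positive cone of the form of signature `(n, 1)` and its
complement multiplies the form by a positive constant. -/
theorem exists_lorentzForm_map_eq_mul (hA : ∀ z, A z ∈ domainD n ↔ z ∈ domainD n) (i : Fin n) :
    ∃ r : ℝ, 0 < r ∧ ∀ z, lorentzForm (A z) = r * lorentzForm z := by
  -- On the real line x + t y the form has two null points, and A keeps them null; compare the
  -- products of the roots.
  have key : ∀ x y : Fin (n + 1) → ℂ, lorentzForm x < 0 → 0 < lorentzForm y →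
      lorentzForm (A x) * lorentzForm y = lorentzForm x * lorentzForm (A y) := by
    intro x y hx hy
    obtain ⟨B, hB⟩ := exists_lorentzForm_add_smul x y
    obtain ⟨B', hB'⟩ := exists_lorentzForm_add_smul (A x) (A y)
    refine mul_eq_mul_of_quadratic_roots (b := B) (b' := B') hy hx fun t ht => ?_
    rw [← hB', ← map_smul, ← map_add]
    exact lorentzForm_map_eq_zero hA i (by rw [hB, ht])
  set e : Fin (n + 1) → ℂ := Pi.single 0 1
  set p : Fin (n + 1) → ℂ := Pi.single i.succ 1
  have he : lorentzForm e = -1 := lorentzForm_single_zero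
  have hp : lorentzForm p = 1 := lorentzForm_single_succ i
  have hep := key e p (by linarith) (by linarith)
  rw [he, hp] at hep
  refine ⟨lorentzForm (A p), (hA p).2 (by rw [mem_domainD, hp]; exact one_pos), fun z => ?_⟩
  rcases lt_trichotomy (lorentzForm z) 0 with h | h | h
  · have := key z p h (by linarith)
    rw [hp] at this
    linarith
  · rw [h, lorentzForm_map_eq_zero hA i h, mul_zero]
  · have := key e z (by linarith) h
    rw [he] at this
    linear_combination this - lorentzForm z * hep

/-- For `n > 1`, a linear map that rescales the form by `r` maps some vector of norm one and
vanishing zeroth coordinate to a vector with vanishing zeroth coordinate. -/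
theorem exists_lorentzForm_eq_one_of_apply_zero (hn : 1 < n)
    (A : (Fin (n + 1) → ℂ) →ₗ[ℂ] (Fin (n + 1) → ℂ)) :
    ∃ h : Fin (n + 1) → ℂ, h 0 = 0 ∧ A h 0 = 0 ∧ lorentzForm h = 1 := by
  set π : (Fin (n + 1) → ℂ) →ₗ[ℂ] ℂ := LinearMap.proj 0
  -- Two linear conditions on a space of dimension n + 1 > 2.
  have hker : LinearMap.ker (π.prod (π ∘ₗ A)) ≠ ⊥ := by
    apply LinearMap.ker_ne_bot_of_finrank_lt
    simp only [Module.finrank_prod, Module.finrank_self, Module.finrank_fin_fun]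
    omega
  obtain ⟨h, hh, hne⟩ := Submodule.exists_mem_ne_zero_of_ne_bot hker
  have h12 : h 0 = 0 ∧ A h 0 = 0 := by simpa [π] using hh
  have hpos : 0 < lorentzForm h := by
    obtain ⟨j, hj⟩ := Function.ne_iff.1 hne
    revert hj
    refine Fin.cases (fun hj => absurd h12.1 hj) (fun i hi => ?_) j
    refine mem_domainD.1 (mem_domainD_of_norm_lt i ?_)
    rw [h12.1, norm_zero]
    exact norm_pos_iff.2 hi
  refine ⟨((Real.sqrt (lorentzForm h))⁻¹ : ℝ) • h, by simp [h12.1], ?_, ?_⟩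
  · rw [← Complex.coe_smul, map_smul]; simp [h12.2]
  · rw [← Complex.coe_smul, lorentzForm_smul, Complex.norm_real, Real.norm_eq_abs, sq_abs,
      inv_pow, Real.sq_sqrt hpos.le, inv_mul_cancel₀ hpos.ne']

end Conformal

/-! ### Cocompactness and the compactness of slices -/

section Quotient

/-- A compact quotient of a locally compact space by a group acting by homeomorphisms is covered
by the translates of a compact set. -/
theorem exists_isCompact_forall_exists_smul_eq {G X : Type*} [Group G] [TopologicalSpace X]
    [LocallyCompactSpace X] [MulAction G X] [ContinuousConstSMul G X]
    [CompactSpace (MulAction.orbitRel.Quotient G X)] :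
    ∃ K : Set X, IsCompact K ∧ ∀ x : X, ∃ g : G, ∃ k ∈ K, g • k = x := by
  choose C hC hCn using fun x : X => exists_compact_mem_nhds x
  let q : X → MulAction.orbitRel.Quotient G X := Quotient.mk''
  have hq : IsOpenMap q := isOpenMap_quotient_mk'_mul
  obtain ⟨t, -, ht⟩ := (isCompact_univ (X := MulAction.orbitRel.Quotient G X)).elim_nhds_subcover
    (fun y => q '' C y.out) fun y _ => by
      have := hq.image_mem_nhds (hCn y.out)
      rwa [show q y.out = y from Quotient.out_eq' y] at this
  refine ⟨⋃ y ∈ t, C y.out, t.isCompact_biUnion fun y _ => hC _, fun x => ?_⟩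
  obtain ⟨y, hy, k, hk, hkx⟩ := Set.mem_iUnion₂.1 (ht (Set.mem_univ (q x)))
  obtain ⟨g, hg⟩ := (MulAction.orbitRel_apply.1 (Quotient.eq''.1 hkx.symm) :
    x ∈ MulAction.orbit G k)
  exact ⟨g, k, Set.mem_iUnion₂.2 ⟨y, hy, hk⟩, hg⟩

variable {n : ℕ}

instance (Γ : Subgroup (HolAut (domainD n))) : ContinuousConstSMul Γ (domainD n) :=
  ⟨fun γ => ((γ : HolAut (domainD n)) : domainD n ≃ₜ domainD n).continuous⟩

/-- On z 0 = 0 the form is positive definite, which bounds the set; the lower bound c⁻¹ keeps it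
closed in ℂ^{n+1}. -/
theorem isCompact_lorentzForm_mem_Icc {c : ℝ} (hc : 0 < c) :
    IsCompact {z : domainD n | (z : Fin (n + 1) → ℂ) 0 = 0 ∧
      lorentzForm (z : Fin (n + 1) → ℂ) ∈ Set.Icc c⁻¹ c} := by
  have himg : ((↑) : domainD n → Fin (n + 1) → ℂ) '' {z : domainD n |
      (z : Fin (n + 1) → ℂ) 0 = 0 ∧ lorentzForm (z : Fin (n + 1) → ℂ) ∈ Set.Icc c⁻¹ c} =
      {z | z 0 = 0 ∧ lorentzForm z ∈ Set.Icc c⁻¹ c} := by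
    ext z
    constructor
    · rintro ⟨w, hw, rfl⟩; exact hw
    · intro hz
      exact ⟨⟨z, mem_domainD.2 ((inv_pos.2 hc).trans_le hz.2.1)⟩, hz, rfl⟩
  rw [Topology.IsInducing.subtypeVal.isCompact_iff]
  refine himg ▸ Metric.isCompact_of_isClosed_isBounded ?_ ?_
  · exact (isClosed_eq (continuous_apply 0) continuous_const).inter
      (isClosed_Icc.preimage continuous_lorentzForm)
  · refine isBounded_iff_forall_norm_le.2 ⟨1 + c, fun z hz => ?_⟩
    refine (pi_norm_le_iff_of_nonneg (by positivity)).2 fun j => ?_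
    refine Fin.cases ?_ (fun i => ?_) j
    · rw [hz.1, norm_zero]; positivity
    · have h1 := hz.2.2
      rw [lorentzForm, hz.1, norm_zero] at h1
      have h2 : ‖z i.succ‖ ^ 2 ≤ ∑ i : Fin n, ‖z i.succ‖ ^ 2 :=
        Finset.single_le_sum (f := fun i : Fin n => ‖z i.succ‖ ^ 2) (fun _ _ => by positivity)
          (Finset.mem_univ i)
      nlinarith [sq_nonneg (‖z i.succ‖ - 1), norm_nonneg (z i.succ)]

/-- The witness has coordinates a and √(1 + a²) in positions 0 and i + 1, with a > N. -/
theorem exists_lorentzForm_eq_one_of_lt_norm (i : Fin n) (N : ℝ) :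
    ∃ z : Fin (n + 1) → ℂ, lorentzForm z = 1 ∧ N < ‖z‖ := by
  set a : ℝ := |N| + 1 with ha
  set b : ℝ := Real.sqrt (1 + a ^ 2) with hb
  set z : Fin (n + 1) → ℂ := Function.update (Pi.single i.succ (b : ℂ)) 0 (a : ℂ) with hz
  have hz0 : ‖z 0‖ = a := by
    rw [hz, Function.update_self, Complex.norm_real, Real.norm_eq_abs,
      abs_of_nonneg (by positivity)]
  refine ⟨z, ?_, ?_⟩
  · have h : ∀ k : Fin n, ‖z k.succ‖ ^ 2 = if k = i then b ^ 2 else 0 := by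
      intro k
      rw [hz, Function.update_of_ne (Fin.succ_ne_zero k)]
      by_cases hk : k = i
      · subst hk; simp
      · simp [hk]
    rw [lorentzForm, Finset.sum_congr rfl fun k _ => h k, hz0]
    simp only [Finset.sum_ite_eq', Finset.mem_univ, if_true]
    rw [hb, Real.sq_sqrt (by positivity)]
    ring
  · have := norm_le_pi_norm z 0
    rw [hz0] at this
    linarith [le_abs_self N]

end Quotient

/-! ### The contradiction with compactness -/

theorem theorem3 (n : ℕ) (hn : 1 < n) (Γ : Subgroup (HolAut (domainD n)))
    (hdisc : DiscreteTopology Γ) (hprop : ProperlyDiscontinuousSMul Γ (domainD n)) :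
    ¬ CompactSpace (MulAction.orbitRel.Quotient Γ (domainD n)) := by
  intro hcompact
  set i : Fin n := ⟨0, by omega⟩
  have : LocallyCompactSpace (domainD n) := (domainD n).isOpen.locallyCompactSpace
  obtain ⟨K, hK, hcover⟩ := exists_isCompact_forall_exists_smul_eq (G := Γ) (X := domainD n)
  have hQc : Continuous fun z : domainD n => lorentzForm (z : Fin (n + 1) → ℂ) :=
    continuous_lorentzForm.comp continuous_subtype_val
  have hQpos : ∀ z : domainD n, 0 < lorentzForm (z : Fin (n + 1) → ℂ) := fun z => z.2
  obtain ⟨c, hc, hcK⟩ : ∃ c : ℝ, 1 ≤ c ∧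
      ∀ z ∈ K, lorentzForm (z : Fin (n + 1) → ℂ) ∈ Set.Icc c⁻¹ c := by
    obtain ⟨M, hM⟩ := hK.bddAbove_image hQc.continuousOn
    obtain ⟨M', hM'⟩ := hK.bddAbove_image (hQc.inv₀ fun z => (hQpos z).ne').continuousOn
    refine ⟨max 1 (max M M'), le_max_left _ _, fun z hz => ⟨?_, ?_⟩⟩
    · refine inv_le_of_inv_le₀ (hQpos z) ?_
      exact (hM' ⟨z, hz, rfl⟩).trans ((le_max_right _ _).trans (le_max_right _ _))
    · exact (hM ⟨z, hz, rfl⟩).trans ((le_max_left _ _).trans (le_max_right _ _))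
  have hc0 : 0 < c := one_pos.trans_le hc
  set L := {z : domainD n | (z : Fin (n + 1) → ℂ) 0 = 0 ∧
    lorentzForm (z : Fin (n + 1) → ℂ) ∈ Set.Icc c⁻¹ c} with hLdef
  have hL : IsCompact L := isCompact_lorentzForm_mem_Icc hc0
  have hfin := hprop.finite_disjoint_inter_image hL hL
  set T := {γ : Γ | ((γ • ·) '' L ∩ L).Nonempty} with hT
  -- The scaling factor of γ is the inverse of the form at k, hence in [c⁻¹, c]; the vector h with h
  -- 0 = (A h) 0 = 0 then lies in L together with its image.
  have hmem : ∀ (γ : Γ) (k : domainD n), k ∈ K →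
      lorentzForm ((γ • k : domainD n) : Fin (n + 1) → ℂ) = 1 → γ ∈ T := by
    intro γ k hk h1
    obtain ⟨A, hAγ, hAD⟩ := exists_linearMap_of_holAut hn (γ : HolAut (domainD n))
    have hAγ' : ∀ z : domainD n, A z = ((γ • z : domainD n) : Fin (n + 1) → ℂ) := hAγ
    obtain ⟨r, hr, hAr⟩ := exists_lorentzForm_map_eq_mul hAD i
    obtain ⟨h, h0, hA0, hh⟩ := exists_lorentzForm_eq_one_of_apply_zero hn A
    rw [← hAγ', hAr] at h1
    have hr' : r = (lorentzForm (k : Fin (n + 1) → ℂ))⁻¹ := eq_inv_of_mul_eq_one_left h1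
    have hrc : r ∈ Set.Icc c⁻¹ c := by
      rw [hr']
      exact ⟨inv_anti₀ (hQpos k) (hcK k hk).2, inv_le_of_inv_le₀ hc0 (hcK k hk).1⟩
    set x : domainD n := ⟨h, by rw [mem_domainD, hh]; exact one_pos⟩ with hx
    have hxL : x ∈ L := ⟨h0, by
      simp only [hx, hh]; exact ⟨inv_le_one_of_one_le₀ hc, hc⟩⟩
    refine ⟨γ • x, ⟨x, hxL, rfl⟩, ?_, ?_⟩
    · rw [← hAγ']; exact hA0
    · rw [← hAγ', hAr, hx, hh, mul_one]; exact hrc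
  -- This compact set would contain the whole unbounded level set where the form is 1.
  have hcpt : IsCompact (⋃ γ ∈ T,
      (fun z : domainD n => ((γ • z : domainD n) : Fin (n + 1) → ℂ)) '' K) :=
    hfin.isCompact_biUnion fun γ _ =>
      hK.image (continuous_subtype_val.comp (continuous_const_smul γ))
  obtain ⟨N, hN⟩ := isBounded_iff_forall_norm_le.1 hcpt.isBounded
  obtain ⟨z, hz1, hzN⟩ := exists_lorentzForm_eq_one_of_lt_norm i N
  obtain ⟨γ, k, hk, hkz⟩ := hcover ⟨z, by rw [mem_domainD, hz1]; exact one_pos⟩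
  have hkz' : ((γ • k : domainD n) : Fin (n + 1) → ℂ) = z := congrArg Subtype.val hkz
  refine (hN z (Set.mem_iUnion₂.2 ⟨γ, hmem γ k hk (by rw [hkz', hz1]), k, hk, hkz'⟩)).not_gt hzN
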